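/- Let $\ell \ge 3$ be an integer. For a box $(i,j)$ (row $i$, column $j$) of the Young diagram of a partition $\lambda$ (English convention), let $\mathrm{arm}(i,j)$ be the number of boxes to its right in its row, $\mathrm{leg}(i,j)$ the number of boxes below it in its column, and $h^\lambda_{(i,j)} = \mathrm{arm}(i,j)+\mathrm{leg}(i,j)+1$ its hook length. The residue of a position $(a,b)$ is $b-a \bmod \ell$. The ladder of a position $(a,b)$ is the set of positions $(c,d)$ with $c,d \ge 1$ and $c+(\ell-1)d = a+(\ell-1)b$; all positions of a ladder have the same residue. For a partition $\lambda$ and $i \in \mathbb{Z}/\ell\mathbb{Z}$, write a $+$ for every addable box of residue $i$ and a $-$ for every removable box of residue $i$, reading the ladders of residue $i$ from left to right and each ladder from top to bottom, and repeatedly cancel adjacent pairs $-+$ until a word $+\cdots+-\cdots-$ remains. Let $\widehat f_i\lambda$ be $\lambda$ together with the box of the rightmost remaining $+$, or $0$ if no $+$ remains. The nodes of the ladder crystal $B(\Lambda_0)^L$ are the partitions obtained from the empty partition by applying the operators $\widehat f_i$, $i \in \mathbb{Z}/\ell\mathbb{Z}$, any number of times. Then a partition $\lambda$ is a node of $B(\Lambda_0)^L$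 if and only if there is no box $(i,j)$ of $\lambda$ with $h^\lambda_{(i,j)} = \ell\cdot \mathrm{arm}(i,j)$. In particular, every L-partition is a node of $B(\Lambda_0)^L$, where an L-partition is a partition with no box $(i,j)$ such that $\ell \mid h^\lambda_{(i,j)}$, $\mathrm{arm}(i,j) < (\ell-1)\,\mathrm{leg}(i,j)$ and $\mathrm{leg}(i,j) < (\ell-1)\,\mathrm{arm}(i,j)$. -/

import Mathlib

/-!  Partitions are Young diagrams (`YoungDiagram`, English convention).  A box is a pair
`(row, column)` of natural numbers, both counted from `0`. -/

namespace LadderCrystal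

/-- The arm of a box: the number of boxes of the diagram strictly to its right in its row. -/
def arm (μ : YoungDiagram) (x : ℕ × ℕ) : ℕ := μ.rowLen x.1 - (x.2 + 1)

/-- The leg of a box: the number of boxes of the diagram strictly below it in its column. -/
def leg (μ : YoungDiagram) (x : ℕ × ℕ) : ℕ := μ.colLen x.2 - (x.1 + 1)

/-- The hook length of a box: the number of boxes to the right and below, itself included. -/
def hook (μ : YoungDiagram) (x : ℕ × ℕ) : ℕ := arm μ x + leg μ x + 1

/-- An L-partition has no box whose hook length is divisible by `ℓ` and which satisfies both
`arm < (ℓ - 1) * leg` and `leg < (ℓ - 1) * arm`. -/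
def IsLPartition (ℓ : ℕ) (μ : YoungDiagram) : Prop :=
  ¬ ∃ x ∈ μ.cells, ℓ ∣ hook μ x ∧
    arm μ x < (ℓ - 1) * leg μ x ∧ leg μ x < (ℓ - 1) * arm μ x

/-- The residue `column - row` modulo `ℓ`. -/
def residue (ℓ : ℕ) (x : ℕ × ℕ) : ZMod ℓ := (x.2 : ZMod ℓ) - (x.1 : ZMod ℓ)

/-- The number of the ladder through a position: two positions are on the same ladder iff one
reaches the other by steps of one column to the right and `ℓ - 1` rows up.  Ladder `k` meets the
first column in row `k`, so ladders are numbered from left to right. -/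
def ladder (ℓ : ℕ) (x : ℕ × ℕ) : ℕ := x.1 + (ℓ - 1) * x.2

/-- A position outside the diagram whose addition yields a partition. -/
def IsAddable (μ : YoungDiagram) (x : ℕ × ℕ) : Prop :=
  x ∉ μ.cells ∧ IsLowerSet ((insert x μ.cells : Finset (ℕ × ℕ)) : Set (ℕ × ℕ))

/-- A box of the diagram whose removal yields a partition. -/
def IsRemovable (μ : YoungDiagram) (x : ℕ × ℕ) : Prop :=
  x ∈ μ.cells ∧ IsLowerSet ((μ.cells.erase x : Finset (ℕ × ℕ)) : Set (ℕ × ℕ))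

/-- The positions with row and column at most `n`, ladder by ladder from left to right, and from
top to bottom on each ladder.  All addable and removable boxes of a partition of `n` occur. -/
def readingOrder (ℓ n : ℕ) : List (ℕ × ℕ) :=
  (List.range (ℓ * n + 1)).flatMap fun k =>
    ((List.range (n + 1)).product (List.range (n + 1))).filter fun x => ladder ℓ x = k

open Classical in
/-- The ladder `i`-signature: the addable `i`-boxes (sign `+`, encoded as `true`) and the removable
`i`-boxes (sign `-`, encoded as `false`), in reading order. -/
noncomputable def signature (ℓ : ℕ) (i : ZMod ℓ) (μ : YoungDiagram) : List (Bool × (ℕ × ℕ)) :=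
  ((readingOrder ℓ μ.card).filter fun x =>
      residue ℓ x = i ∧ (IsAddable μ x ∨ IsRemovable μ x)).map
    fun x => (decide (IsAddable μ x), x)

/-- Put one signed box in front of a reduced word; a `-` in front of a `+` cancels against it. -/
def consCancel : Bool × (ℕ × ℕ) → List (Bool × (ℕ × ℕ)) → List (Bool × (ℕ × ℕ))
  | (false, _), (true, _) :: w => w
  | s, w => s :: w

/-- The reduced word, of the form `+ ⋯ + - ⋯ -`: all adjacent pairs `- +` are cancelled,
repeatedly. -/
def reduceWord (w : List (Bool × (ℕ × ℕ))) : List (Bool × (ℕ × ℕ)) := w.foldr consCancel []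

/-- The ladder cogood `i`-box: the box of the rightmost `+` of the reduced ladder `i`-signature,
if there is one. -/
noncomputable def cogoodBox (ℓ : ℕ) (i : ZMod ℓ) (μ : YoungDiagram) : Option (ℕ × ℕ) :=
  (((reduceWord (signature ℓ i μ)).filter fun s => s.1).getLast?).map fun s => s.2

open Classical in
/-- The diagram with one more box, if that is the diagram of a partition. -/
noncomputable def addBox (μ : YoungDiagram) (x : ℕ × ℕ) : Option YoungDiagram :=
  if h : IsLowerSet ((insert x μ.cells : Finset (ℕ × ℕ)) : Set (ℕ × ℕ)) then
    some ⟨insert x μ.cells, h⟩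
  else none

/-- The ladder crystal operator `f̂ᵢ`, which adds the ladder cogood `i`-box.  The value `0`
is encoded as `none`. -/
noncomputable def fHat (ℓ : ℕ) (i : ZMod ℓ) (μ : YoungDiagram) : Option YoungDiagram :=
  (cogoodBox ℓ i μ).bind (addBox μ)

/-- The nodes of the ladder crystal `B(Λ₀)^L`: the partitions obtained from the empty one by
applying the operators `f̂ᵢ`. -/
inductive IsNode (ℓ : ℕ) : YoungDiagram → Prop
  | empty : IsNode ℓ ⊥
  | step {μ ν : YoungDiagram} (i : ZMod ℓ) : IsNode ℓ μ → fHat ℓ i μ = some ν → IsNode ℓ ν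

end LadderCrystal

namespace LadderCrystal

/-! ### Cancellation in words of signs -/

/-! With row length `R` and column length `C` of a box `(r, c)`, the equation `hook = ℓ * arm` says
`r + (ℓ - 1) R = C + (ℓ - 1) (c + 1)`: the position after the end of row `r` is on the ladder of the
position one step right of the bottom of column `c`. So the forbidden boxes are coincidences between
ladders, and their absence is called `IsLadderFree`.

This property is inherited in both directions along an arrow of the crystal. Adding `x` alters only
its row and its column. A coincidence created there yields an addable box of the residue of `x` read
after `x`, or else it was present already in a neighbouring row or column. Since `x` is the
rightmost surviving `+`, a removable box lies in between, and that box gives a coincidence in the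
old diagram (`isLadderFree_of_isExtension`). Removing the leftmost surviving `-` is dual
(`isLadderFree_of_isExtension'`) and inverts the operator, as it turns this `-` into the rightmost
surviving `+`.

Finally, a nonempty ladder-free diagram always has a surviving `-`
(`IsLadderFree.exists_false_mem_reduceWord`), so induction on the number of boxes reaches the empty
diagram. -/

theorem reduceWord_cons (a : Bool × (ℕ × ℕ)) (w : List (Bool × (ℕ × ℕ))) :
    reduceWord (a :: w) = consCancel a (reduceWord w) := rfl

theorem consCancel_true (x : ℕ × ℕ) (w : List (Bool × (ℕ × ℕ))) :
    consCancel (true, x) w = (true, x) :: w := by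
  simp [consCancel]

theorem consCancel_false_of_forall_false (x : ℕ × ℕ) {w : List (Bool × (ℕ × ℕ))}
    (hw : ∀ s ∈ w, s.1 = false) : consCancel (false, x) w = (false, x) :: w := by
  match w, hw with
  | [], _ => rfl
  | (false, y) :: w, _ => rfl
  | (true, y) :: w, hw => simp at hw

theorem mem_consCancel_of_mem_of_false {a s : Bool × (ℕ × ℕ)} {w : List (Bool × (ℕ × ℕ))}
    (hs : s ∈ w) (hf : s.1 = false) : s ∈ consCancel a w := by
  match a, w with
  | (true, _), w => simp [consCancel_true, hs]
  | (false, _), [] => simp at hs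
  | (false, _), (false, _) :: w => simp only [consCancel]; exact List.mem_cons_of_mem _ hs
  | (false, _), (true, _) :: w =>
    rcases List.mem_cons.1 hs with rfl | hs
    · simp at hf
    · exact hs

/-- A word whose reduction has no `-` does not interact with what follows it. -/
theorem reduceWord_append {u : List (Bool × (ℕ × ℕ))} (z : List (Bool × (ℕ × ℕ)))
    (hu : ∀ s ∈ reduceWord u, s.1 = true) :
    reduceWord (u ++ z) = reduceWord u ++ reduceWord z := by
  induction u with
  | nil => rfl
  | cons a u ih =>
    have hu' : ∀ s ∈ reduceWord u, s.1 = true := by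
      intro s hs
      by_contra hf
      exact hf (hu s (mem_consCancel_of_mem_of_false hs (by simpa using hf)))
    rw [List.cons_append, reduceWord_cons, reduceWord_cons, ih hu']
    rw [reduceWord_cons] at hu
    obtain ⟨_ | _, x⟩ := a
    · match h : reduceWord u with
      | [] => rw [h] at hu; simp [consCancel] at hu
      | (true, y) :: t => rfl
      | (false, y) :: t => rw [h] at hu'; simp at hu'
    · simp [consCancel_true]

/-- A `+` can be cancelled only by a `-` to its left. -/
theorem exists_true_mem_reduceWord {w₁ w₂ : List (Bool × (ℕ × ℕ))} {y : ℕ × ℕ}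
    (h : ∀ s ∈ w₁, s.1 = true) : (true, y) ∈ reduceWord (w₁ ++ (true, y) :: w₂) := by
  induction w₁ with
  | nil => simp [reduceWord_cons, consCancel_true]
  | cons a w₁ ih =>
    obtain ⟨b, x⟩ := a
    obtain rfl : b = true := h _ List.mem_cons_self
    rw [List.cons_append, reduceWord_cons, consCancel_true]
    exact List.mem_cons_of_mem _ (ih fun s hs => h s (List.mem_cons_of_mem _ hs))

theorem reduceWord_of_forall_false {w : List (Bool × (ℕ × ℕ))} (h : ∀ s ∈ w, s.1 = false) :
    reduceWord w = w := by
  induction w with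
  | nil => rfl
  | cons a w ih =>
    obtain ⟨b, x⟩ := a
    obtain rfl : b = false := h _ List.mem_cons_self
    have hw : ∀ s ∈ w, s.1 = false := fun s hs => h s (List.mem_cons_of_mem _ hs)
    rw [reduceWord_cons, ih hw, consCancel_false_of_forall_false x hw]

/-- A `-` can be cancelled only by a `+` to its right, and prepending letters never deletes it. -/
theorem false_mem_reduceWord {w₁ w₂ : List (Bool × (ℕ × ℕ))} {y : ℕ × ℕ}
    (h : ∀ s ∈ w₂, s.1 = false) : (false, y) ∈ reduceWord (w₁ ++ (false, y) :: w₂) := by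
  induction w₁ with
  | nil =>
    rw [List.nil_append, reduceWord_of_forall_false]
    · exact List.mem_cons_self
    · rintro s (_ | ⟨_, hs⟩)
      · rfl
      · exact h s hs
  | cons a w₁ ih => exact mem_consCancel_of_mem_of_false ih rfl

/-- The rightmost `+` of the reduced word, located in the original word. -/
theorem exists_eq_append_of_getLast?_reduceWord {w : List (Bool × (ℕ × ℕ))}
    {s : Bool × (ℕ × ℕ)} (h : ((reduceWord w).filter fun s => s.1).getLast? = some s) :
    s.1 = true ∧ ∃ u v, w = u ++ s :: v ∧ ∀ t ∈ reduceWord v, t.1 = false := by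
  induction w with
  | nil => simp [reduceWord] at h
  | cons a w ih =>
    have key (h : ((reduceWord w).filter fun s => s.1).getLast? = some s) :
        s.1 = true ∧ ∃ u v, a :: w = u ++ s :: v ∧ ∀ t ∈ reduceWord v, t.1 = false := by
      obtain ⟨hs, u, v, rfl, hv⟩ := ih h
      exact ⟨hs, a :: u, v, rfl, hv⟩
    obtain ⟨_ | _, x⟩ := a
    · rw [reduceWord_cons] at h
      match hw : reduceWord w with
      | [] => rw [hw] at h; simp [consCancel] at h
      | (false, y) :: t =>
        rw [hw] at h
        apply key
        rw [hw]
        simpa [consCancel] using h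
      | (true, y) :: t =>
        rw [hw] at h
        apply key
        rw [hw]
        simp only [consCancel] at h
        rw [List.filter_cons_of_pos rfl, List.getLast?_cons, h]
        rfl
    · rw [reduceWord_cons, consCancel_true, List.filter_cons_of_pos rfl] at h
      by_cases hn : (reduceWord w).filter (fun s => s.1) = []
      · rw [hn] at h
        obtain rfl : (true, x) = s := by simpa using h
        refine ⟨rfl, [], w, rfl, fun t ht => ?_⟩
        simpa using List.filter_eq_nil_iff.1 hn t ht
      · rw [List.getLast?_cons_of_ne_nil hn] at h
        exact key h

/-- The leftmost `-` of the reduced word, located in the original word. -/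
theorem exists_eq_append_of_false_mem_reduceWord {w : List (Bool × (ℕ × ℕ))}
    (h : ∃ s ∈ reduceWord w, s.1 = false) :
    ∃ u x v, w = u ++ (false, x) :: v ∧ (∀ t ∈ reduceWord u, t.1 = true) ∧
      ∀ t ∈ reduceWord v, t.1 = false := by
  induction w with
  | nil => simp [reduceWord] at h
  | cons a w ih =>
    by_cases hw : ∃ s ∈ reduceWord w, s.1 = false
    · obtain ⟨u, x, v, rfl, hu, hv⟩ := ih hw
      by_cases hau : ∀ t ∈ reduceWord (a :: u), t.1 = true
      · exact ⟨a :: u, x, v, rfl, hau, hv⟩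
      · obtain ⟨_ | _, y⟩ := a
        -- The new `-` survives only if `u` reduces to the empty word, since otherwise it cancels
        -- the first `+`. It is then itself the leftmost surviving `-`.
        · refine ⟨[], y, u ++ (false, x) :: v, rfl, by simp [reduceWord], ?_⟩
          have hu0 : reduceWord u = [] := by
            match h0 : reduceWord u with
            | [] => rfl
            | (false, y) :: t => rw [h0] at hu; simp at hu
            | (true, y) :: t =>
              rw [reduceWord_cons, h0] at hau
              rw [h0] at hu
              exact absurd (fun s hs => hu s (List.mem_cons_of_mem _ hs)) hau
          rw [reduceWord_append _ hu, hu0, reduceWord_cons, consCancel_false_of_forall_false x hv]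
          rintro s (_ | ⟨_, hs⟩)
          · rfl
          · exact hv s hs
        · rw [reduceWord_cons, consCancel_true] at hau
          exact absurd (by simpa using hu) hau
    · have hw' : ∀ s ∈ reduceWord w, s.1 = true := by simpa using hw
      obtain ⟨s, hs, hsf⟩ := h
      rw [reduceWord_cons] at hs
      obtain ⟨_ | _, y⟩ := a
      · match h0 : reduceWord w with
        | [] => exact ⟨[], y, w, rfl, by simp [reduceWord], by simp [h0]⟩
        | (false, y) :: t => rw [h0] at hw'; simp at hw'
        | (true, y) :: t =>
          rw [h0] at hs hw'
          have := hw' s (List.mem_cons_of_mem _ hs)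
          simp [hsf] at this
      · rw [consCancel_true] at hs
        rcases List.mem_cons.1 hs with rfl | hs
        · simp at hsf
        · simp [hw' s hs] at hsf

/-- Identifies the cogood box once the leftmost surviving `-` has been turned into `+`. -/
theorem getLast?_filter_reduceWord {u v : List (Bool × (ℕ × ℕ))} {x : ℕ × ℕ}
    (hu : ∀ t ∈ reduceWord u, t.1 = true) (hv : ∀ t ∈ reduceWord v, t.1 = false) :
    ((reduceWord (u ++ (true, x) :: v)).filter fun s => s.1).getLast? = some (true, x) := by
  have hv' : (reduceWord v).filter (fun s => s.1) = [] :=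
    List.filter_eq_nil_iff.2 fun t ht => by simp [hv t ht]
  rw [reduceWord_append _ hu, reduceWord_cons, consCancel_true, List.filter_append,
    List.filter_cons_of_pos rfl, hv', List.getLast?_concat]

/-! ### The reading order -/

/-- `x` is read before `y`. -/
def ReadsBefore (ℓ : ℕ) (x y : ℕ × ℕ) : Prop :=
  ladder ℓ x < ladder ℓ y ∨ ladder ℓ x = ladder ℓ y ∧ x.1 < y.1

theorem ReadsBefore.asymm {ℓ : ℕ} {x y : ℕ × ℕ} (h : ReadsBefore ℓ x y) :
    ¬ ReadsBefore ℓ y x := by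
  unfold ReadsBefore at *; omega

theorem pairwise_readingOrder {ℓ : ℕ} (hℓ : 2 ≤ ℓ) (n : ℕ) :
    (readingOrder ℓ n).Pairwise (ReadsBefore ℓ) := by
  unfold readingOrder
  rw [List.pairwise_flatMap]
  constructor
  · intro k _
    have h : ((List.range (n + 1)).product (List.range (n + 1))).Pairwise
        fun x y => x.1 < y.1 ∨ x.1 = y.1 ∧ x.2 < y.2 := by
      unfold List.product
      rw [List.pairwise_flatMap]
      refine ⟨fun a _ => ?_, List.pairwise_lt_range.imp fun hab x hx y hy => ?_⟩
      · rw [List.pairwise_map]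
        exact List.pairwise_lt_range.imp fun h => Or.inr ⟨rfl, h⟩
      · simp only [List.mem_map] at hx hy
        obtain ⟨_, _, rfl⟩ := hx
        obtain ⟨_, _, rfl⟩ := hy
        exact Or.inl hab
    refine (h.filter _).imp_of_mem fun {x y} hx hy hxy => ?_
    have hx := of_decide_eq_true (List.mem_filter.1 hx).2
    have hy := of_decide_eq_true (List.mem_filter.1 hy).2
    refine Or.inr ⟨hx.trans hy.symm, ?_⟩
    rcases hxy with hxy | ⟨h1, h2⟩
    · exact hxy
    · have := Nat.mul_lt_mul_of_pos_left h2 (show 0 < ℓ - 1 by omega)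
      unfold ladder at hx hy
      omega
  · refine List.pairwise_lt_range.imp fun {a b} hab x hx y hy => Or.inl ?_
    have hx := of_decide_eq_true (List.mem_filter.1 hx).2
    have hy := of_decide_eq_true (List.mem_filter.1 hy).2
    omega

theorem mem_readingOrder {ℓ n : ℕ} (hℓ : 1 ≤ ℓ) {x : ℕ × ℕ} :
    x ∈ readingOrder ℓ n ↔ x.1 ≤ n ∧ x.2 ≤ n := by
  obtain ⟨m, rfl⟩ : ∃ m, ℓ = m + 1 := ⟨ℓ - 1, by omega⟩
  obtain ⟨r, c⟩ := x
  simp only [readingOrder, List.mem_flatMap, List.mem_range, List.mem_filter,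
    List.pair_mem_product, decide_eq_true_eq, ladder, Nat.add_sub_cancel]
  constructor
  · rintro ⟨k, _, h, _⟩
    omega
  · rintro ⟨h1, h2⟩
    refine ⟨_, ?_, ⟨by omega, by omega⟩, rfl⟩
    have := Nat.mul_le_mul_left m h2
    rw [Nat.add_mul]
    omega

/-- Modulo `ℓ`, `ℓ - 1` is `-1`, so the residue is minus the ladder number. Ladders of equal residue
are therefore a multiple of `ℓ` apart. -/
theorem residue_eq_iff {ℓ : ℕ} (hℓ : 1 ≤ ℓ) {x y : ℕ × ℕ} :
    residue ℓ x = residue ℓ y ↔ ladder ℓ x ≡ ladder ℓ y [MOD ℓ] := by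
  have h (x : ℕ × ℕ) : residue ℓ x = -((ladder ℓ x : ℕ) : ZMod ℓ) := by
    simp only [residue, ladder]
    push_cast [Nat.cast_sub hℓ]
    rw [ZMod.natCast_self]
    ring
  rw [h, h, neg_inj, ZMod.natCast_eq_natCast_iff]

/-! ### Boxes that can be added or removed -/

theorem isAddable_iff {μ : YoungDiagram} {r c : ℕ} :
    IsAddable μ (r, c) ↔ μ.rowLen r = c ∧ μ.colLen c = r := by
  constructor
  · rintro ⟨h, hl⟩
    have h1 : ¬ c < μ.rowLen r := fun h' => h (YoungDiagram.mem_iff_lt_rowLen.2 h')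
    have h2 : ¬ r < μ.colLen c := fun h' => h (YoungDiagram.mem_iff_lt_colLen.2 h')
    have key (y : ℕ × ℕ) (hy : y ≤ (r, c)) (hne : y ≠ (r, c)) : y ∈ μ := by
      have := hl hy (by simp)
      simpa [hne] using this
    constructor
    · by_contra hne
      have := key (r, c - 1) ⟨le_rfl, Nat.sub_le _ _⟩ (by simp; omega)
      rw [YoungDiagram.mem_iff_lt_rowLen] at this
      omega
    · by_contra hne
      have := key (r - 1, c) ⟨Nat.sub_le _ _, le_rfl⟩ (by simp; omega)
      rw [YoungDiagram.mem_iff_lt_colLen] at this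
      omega
  · rintro ⟨h1, h2⟩
    refine ⟨fun h => ?_, ?_⟩
    · rw [YoungDiagram.mem_cells, YoungDiagram.mem_iff_lt_rowLen] at h
      omega
    · rintro ⟨a, b⟩ ⟨a', b'⟩ ⟨ha, hb⟩ h
      simp only [Finset.coe_insert, Set.mem_insert_iff, Prod.mk.injEq, Finset.mem_coe,
        YoungDiagram.mem_cells] at h ⊢ ha hb
      rcases h with ⟨rfl, rfl⟩ | h
      · by_cases hb' : b' = b
        · by_cases ha' : a' = a
          · exact Or.inl ⟨ha', hb'⟩
          · right
            rw [YoungDiagram.mem_iff_lt_colLen, hb']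
            omega
        · right
          refine μ.up_left_mem ha le_rfl ?_
          rw [YoungDiagram.mem_iff_lt_rowLen]
          omega
      · exact Or.inr (μ.up_left_mem ha hb h)

theorem isRemovable_iff {μ : YoungDiagram} {r c : ℕ} :
    IsRemovable μ (r, c) ↔ μ.rowLen r = c + 1 ∧ μ.colLen c = r + 1 := by
  constructor
  · rintro ⟨h, hl⟩
    have h1 := YoungDiagram.mem_iff_lt_rowLen.1 h
    have h2 := YoungDiagram.mem_iff_lt_colLen.1 h
    have key (y : ℕ × ℕ) (hy : (r, c) ≤ y) (hne : y ≠ (r, c)) : y ∉ μ := by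
      intro hm
      have := hl hy (by simpa [hne] using hm)
      simp at this
    constructor
    · have := key (r, c + 1) ⟨le_rfl, Nat.le_succ _⟩ (by simp)
      rw [YoungDiagram.mem_iff_lt_rowLen] at this
      omega
    · have := key (r + 1, c) ⟨Nat.le_succ _, le_rfl⟩ (by simp)
      rw [YoungDiagram.mem_iff_lt_colLen] at this
      omega
  · rintro ⟨h1, h2⟩
    refine ⟨YoungDiagram.mem_iff_lt_rowLen.2 (by omega), ?_⟩
    rintro ⟨a, b⟩ ⟨a', b'⟩ ⟨ha, hb⟩ h
    simp only [Finset.coe_erase, Set.mem_sdiff, Set.mem_singleton_iff, Prod.mk.injEq,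
      Finset.mem_coe, YoungDiagram.mem_cells] at h ⊢ ha hb
    refine ⟨μ.up_left_mem ha hb h.1, ?_⟩
    rintro ⟨rfl, rfl⟩
    have hr := YoungDiagram.mem_iff_lt_rowLen.1 (μ.up_left_mem ha le_rfl h.1)
    have hc := YoungDiagram.mem_iff_lt_colLen.1 (μ.up_left_mem le_rfl hb h.1)
    exact h.2 ⟨by omega, by omega⟩

theorem IsAddable.not_isRemovable {μ : YoungDiagram} {x : ℕ × ℕ} (h : IsAddable μ x) :
    ¬ IsRemovable μ x := fun h' => h.1 h'.1

theorem rowLen_le_card (μ : YoungDiagram) (r : ℕ) : μ.rowLen r ≤ μ.card := by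
  rw [YoungDiagram.rowLen_eq_card]
  exact Finset.card_le_card (Finset.filter_subset _ _)

theorem colLen_le_card (μ : YoungDiagram) (c : ℕ) : μ.colLen c ≤ μ.card := by
  rw [YoungDiagram.colLen_eq_card]
  exact Finset.card_le_card (Finset.filter_subset _ _)

open Classical in
/-- The addable and removable `i`-boxes in reading order. -/
noncomputable def signedBoxes (ℓ : ℕ) (i : ZMod ℓ) (μ : YoungDiagram) : List (ℕ × ℕ) :=
  (readingOrder ℓ μ.card).filter fun x => residue ℓ x = i ∧ (IsAddable μ x ∨ IsRemovable μ x)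

open Classical in
theorem signature_eq (ℓ : ℕ) (i : ZMod ℓ) (μ : YoungDiagram) :
    signature ℓ i μ = (signedBoxes ℓ i μ).map fun x => (decide (IsAddable μ x), x) := rfl

theorem mem_signedBoxes {ℓ : ℕ} (hℓ : 1 ≤ ℓ) {i : ZMod ℓ} {μ : YoungDiagram} {x : ℕ × ℕ} :
    x ∈ signedBoxes ℓ i μ ↔ residue ℓ x = i ∧ (IsAddable μ x ∨ IsRemovable μ x) := by
  classical
  simp only [signedBoxes, List.mem_filter, decide_eq_true_eq, and_iff_right_iff_imp]
  rintro ⟨-, h⟩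
  rw [mem_readingOrder hℓ]
  obtain ⟨r, c⟩ := x
  have := rowLen_le_card μ r
  have := colLen_le_card μ c
  rw [isAddable_iff, isRemovable_iff] at h
  dsimp only
  omega

theorem pairwise_signedBoxes {ℓ : ℕ} (hℓ : 2 ≤ ℓ) (i : ZMod ℓ) (μ : YoungDiagram) :
    (signedBoxes ℓ i μ).Pairwise (ReadsBefore ℓ) := by
  classical
  exact (pairwise_readingOrder hℓ _).filter _

theorem eq_of_pairwise_readsBefore {ℓ : ℕ} {a b : List (ℕ × ℕ)}
    (ha : a.Pairwise (ReadsBefore ℓ)) (hb : b.Pairwise (ReadsBefore ℓ))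
    (h : ∀ x, x ∈ a ↔ x ∈ b) : a = b := by
  have nd {l : List (ℕ × ℕ)} (hl : l.Pairwise (ReadsBefore ℓ)) : l.Nodup :=
    hl.imp fun {x y} hxy he => by subst he; exact hxy.asymm hxy
  exact List.Perm.eq_of_pairwise (fun x y _ _ hxy hyx => absurd hyx hxy.asymm) ha hb
    ((List.perm_ext_iff_of_nodup (nd ha) (nd hb)).2 h)

theorem exists_signedBoxes_eq_of_signature_eq {ℓ : ℕ} {i : ZMod ℓ} {μ : YoungDiagram}
    {u v : List (Bool × (ℕ × ℕ))} {b : Bool} {x : ℕ × ℕ}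
    (h : signature ℓ i μ = u ++ (b, x) :: v) :
    ∃ p q, signedBoxes ℓ i μ = p ++ x :: q ∧
      (open Classical in p.map fun y => (decide (IsAddable μ y), y)) = u ∧
      (open Classical in q.map fun y => (decide (IsAddable μ y), y)) = v ∧
      (b = true ↔ IsAddable μ x) := by
  rw [signature_eq, List.map_eq_append_iff] at h
  obtain ⟨p, q', h, hp, hq'⟩ := h
  rw [List.map_eq_cons_iff] at hq'
  obtain ⟨x', q, rfl, hx, hq⟩ := hq'
  rw [Prod.mk.injEq] at hx
  obtain ⟨hb, rfl⟩ := hx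
  exact ⟨p, q, h, hp, hq, by classical rw [← hb, decide_eq_true_iff]⟩

/-- An addable box read after an uncancelled box is cancelled by a removable box between. -/
theorem exists_isRemovable_between {ℓ : ℕ} (hℓ : 2 ≤ ℓ) {i : ZMod ℓ} {μ : YoungDiagram}
    {u v : List (Bool × (ℕ × ℕ))} {b : Bool} {x y : ℕ × ℕ}
    (h : signature ℓ i μ = u ++ (b, x) :: v) (hv : ∀ s ∈ reduceWord v, s.1 = false)
    (hy : IsAddable μ y) (hyi : residue ℓ y = i) (hxy : ReadsBefore ℓ x y) :
    ∃ z, IsRemovable μ z ∧ residue ℓ z = i ∧ ReadsBefore ℓ x z ∧ ReadsBefore ℓ z y := by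
  classical
  obtain ⟨p, q, hL, -, hq, -⟩ := exists_signedBoxes_eq_of_signature_eq h
  have hmem (z) : z ∈ signedBoxes ℓ i μ ↔ _ := mem_signedBoxes (by omega)
  have hpw := pairwise_signedBoxes hℓ i μ
  have hyL := (hmem y).2 ⟨hyi, Or.inl hy⟩
  rw [hL] at hyL hpw
  rw [List.pairwise_append, List.pairwise_cons] at hpw
  obtain ⟨-, ⟨hxq, hqq⟩, hpx⟩ := hpw
  have hyq : y ∈ q := by
    rcases List.mem_append.1 hyL with hyp | hyq
    · exact absurd hxy (hpx y hyp x List.mem_cons_self).asymm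
    · rcases List.mem_cons.1 hyq with rfl | hyq
      · exact absurd hxy hxy.asymm
      · exact hyq
  obtain ⟨q₁, q₂, rfl⟩ := List.append_of_mem hyq
  rw [List.pairwise_append] at hqq
  by_contra! hno
  have hall : ∀ s ∈ q₁.map (fun z => (decide (IsAddable μ z), z)), s.1 = true := by
    intro s hs
    obtain ⟨z, hz, rfl⟩ := List.mem_map.1 hs
    have hzL := (hmem z).1 (by rw [hL]; simp [hz])
    rcases hzL.2 with hz' | hz'
    · exact decide_eq_true hz'
    · exact absurd (hqq.2.2 z hz y List.mem_cons_self)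
        (hno z hz' hzL.1 (hxq z (List.mem_append_left _ hz)))
  have := exists_true_mem_reduceWord (y := y)
    (w₂ := q₂.map (fun z => (decide (IsAddable μ z), z))) hall
  rw [List.map_append, List.map_cons, decide_eq_true hy] at hq
  rw [hq] at this
  simpa using hv _ this

/-- A removable box read before an uncancelled box is cancelled by an addable box between. -/
theorem exists_isAddable_between {ℓ : ℕ} (hℓ : 2 ≤ ℓ) {i : ZMod ℓ} {μ : YoungDiagram}
    {u v : List (Bool × (ℕ × ℕ))} {b : Bool} {x y : ℕ × ℕ}
    (h : signature ℓ i μ = u ++ (b, x) :: v) (hu : ∀ s ∈ reduceWord u, s.1 = true)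
    (hy : IsRemovable μ y) (hyi : residue ℓ y = i) (hyx : ReadsBefore ℓ y x) :
    ∃ z, IsAddable μ z ∧ residue ℓ z = i ∧ ReadsBefore ℓ y z ∧ ReadsBefore ℓ z x := by
  classical
  obtain ⟨p, q, hL, hp, -, -⟩ := exists_signedBoxes_eq_of_signature_eq h
  have hmem (z) : z ∈ signedBoxes ℓ i μ ↔ _ := mem_signedBoxes (by omega)
  have hpw := pairwise_signedBoxes hℓ i μ
  have hyL := (hmem y).2 ⟨hyi, Or.inr hy⟩
  rw [hL] at hyL hpw
  rw [List.pairwise_append, List.pairwise_cons] at hpw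
  obtain ⟨hpp, ⟨hxq, -⟩, hpx⟩ := hpw
  have hyp : y ∈ p := by
    rcases List.mem_append.1 hyL with hyp | hyq
    · exact hyp
    · rcases List.mem_cons.1 hyq with rfl | hyq
      · exact absurd hyx hyx.asymm
      · exact absurd hyx (hxq y hyq).asymm
  obtain ⟨p₁, p₂, rfl⟩ := List.append_of_mem hyp
  rw [List.pairwise_append, List.pairwise_cons] at hpp
  by_contra! hno
  have hall : ∀ s ∈ p₂.map (fun z => (decide (IsAddable μ z), z)), s.1 = false := by
    intro s hs
    obtain ⟨z, hz, rfl⟩ := List.mem_map.1 hs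
    have hzL := (hmem z).1 (by rw [hL]; simp [hz])
    refine decide_eq_false fun hz' => ?_
    exact absurd (hpx z (by simp [hz]) x List.mem_cons_self) (hno z hz' hzL.1 (hpp.2.1.1 z hz))
  have := false_mem_reduceWord (y := y)
    (w₁ := p₁.map (fun z => (decide (IsAddable μ z), z))) hall
  rw [List.map_append, List.map_cons, decide_eq_false fun h' => h'.not_isRemovable hy] at hp
  rw [hp] at this
  simpa using hu _ this

/-- A removable box with no addable box of the same residue after it is not cancelled. -/
theorem exists_false_mem_reduceWord_signature {ℓ : ℕ} (hℓ : 2 ≤ ℓ) {μ : YoungDiagram}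
    {x : ℕ × ℕ} (hx : IsRemovable μ x)
    (h : ∀ y, IsAddable μ y → residue ℓ y = residue ℓ x → ¬ ReadsBefore ℓ x y) :
    ∃ s ∈ reduceWord (signature ℓ (residue ℓ x) μ), s.1 = false := by
  classical
  have hmem (z) : z ∈ signedBoxes ℓ (residue ℓ x) μ ↔ _ := mem_signedBoxes (by omega)
  have hpw := pairwise_signedBoxes hℓ (residue ℓ x) μ
  obtain ⟨p, q, hL⟩ := List.append_of_mem ((hmem x).2 ⟨rfl, Or.inr hx⟩)
  rw [hL, List.pairwise_append, List.pairwise_cons] at hpw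
  have hall : ∀ s ∈ q.map (fun z => (decide (IsAddable μ z), z)), s.1 = false := by
    intro s hs
    obtain ⟨z, hz, rfl⟩ := List.mem_map.1 hs
    have hzL := (hmem z).1 (by rw [hL]; simp [hz])
    exact decide_eq_false fun hz' => h z hz' hzL.1 (hpw.2.1.1 z hz)
  refine ⟨(false, x), ?_, rfl⟩
  rw [signature_eq, hL, List.map_append, List.map_cons,
    decide_eq_false fun h' => h'.not_isRemovable hx]
  exact false_mem_reduceWord hall

/-! ### Adding one box -/

/-- `ν` is `μ` with the additional box `x`. -/
def IsExtension (μ ν : YoungDiagram) (x : ℕ × ℕ) : Prop :=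
  x ∉ μ.cells ∧ ν.cells = insert x μ.cells

namespace IsExtension

variable {μ ν : YoungDiagram} {x : ℕ × ℕ} {r c : ℕ}

theorem isAddable (h : IsExtension μ ν x) : IsAddable μ x :=
  ⟨h.1, h.2 ▸ ν.isLowerSet⟩

theorem isRemovable (h : IsExtension μ ν x) : IsRemovable ν x := by
  refine ⟨by simp [h.2], ?_⟩
  rw [h.2, Finset.erase_insert h.1]
  exact μ.isLowerSet

theorem mem_iff (h : IsExtension μ ν x) {y : ℕ × ℕ} : y ∈ ν ↔ y = x ∨ y ∈ μ := by
  rw [← YoungDiagram.mem_cells, h.2, Finset.mem_insert, YoungDiagram.mem_cells]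

theorem rowLen_of_ne (h : IsExtension μ ν (r, c)) {r' : ℕ} (hr : r' ≠ r) :
    ν.rowLen r' = μ.rowLen r' :=
  eq_of_forall_lt_iff fun j => by
    simp [← YoungDiagram.mem_iff_lt_rowLen, h.mem_iff, hr]

theorem colLen_of_ne (h : IsExtension μ ν (r, c)) {c' : ℕ} (hc : c' ≠ c) :
    ν.colLen c' = μ.colLen c' :=
  eq_of_forall_lt_iff fun j => by
    simp [← YoungDiagram.mem_iff_lt_colLen, h.mem_iff, hc]

theorem residue_ne {ℓ a b : ℕ} (hℓ : 2 ≤ ℓ) (h : b + 1 = a ∨ a + 1 = b) (r : ℕ) :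
    residue ℓ (r, a) ≠ residue ℓ (r, b) ∧ residue ℓ (a, r) ≠ residue ℓ (b, r) := by
  have : Fact (1 < ℓ) := ⟨by omega⟩
  unfold residue
  rcases h with rfl | rfl <;> simp

/-- Adding `x` can change the status only of `x` and its four neighbours, and the neighbours have
other residues. -/
theorem isAddable_isRemovable_iff (h : IsExtension μ ν x) {ℓ : ℕ} (hℓ : 2 ≤ ℓ) {y : ℕ × ℕ}
    (hy : residue ℓ y = residue ℓ x) (hne : y ≠ x) :
    (IsAddable ν y ↔ IsAddable μ y) ∧ (IsRemovable ν y ↔ IsRemovable μ y) := by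
  obtain ⟨r, c⟩ := x
  obtain ⟨r', c'⟩ := y
  obtain ⟨h1, h2⟩ := isAddable_iff.1 h.isAddable
  obtain ⟨h3, h4⟩ := isRemovable_iff.1 h.isRemovable
  rw [isAddable_iff, isAddable_iff, isRemovable_iff, isRemovable_iff]
  by_cases hr : r' = r
  · subst hr
    have n1 : ¬ c + 1 = c' := fun he => (residue_ne hℓ (Or.inl he) r').1 hy
    have n2 : ¬ c' + 1 = c := fun he => (residue_ne hℓ (Or.inr he) r').1 hy
    have n3 : c' ≠ c := fun he => hne (by rw [he])
    omega
  · rw [h.rowLen_of_ne hr]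
    by_cases hc : c' = c
    · subst hc
      have n1 : ¬ r + 1 = r' := fun he => (residue_ne hℓ (Or.inl he) c').2 hy
      have n2 : ¬ r' + 1 = r := fun he => (residue_ne hℓ (Or.inr he) c').2 hy
      omega
    · rw [h.colLen_of_ne hc]
      exact ⟨Iff.rfl, Iff.rfl⟩

theorem signedBoxes_eq (h : IsExtension μ ν x) {ℓ : ℕ} (hℓ : 2 ≤ ℓ) :
    signedBoxes ℓ (residue ℓ x) μ = signedBoxes ℓ (residue ℓ x) ν := by
  refine eq_of_pairwise_readsBefore (pairwise_signedBoxes hℓ _ _) (pairwise_signedBoxes hℓ _ _) ?_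
  intro y
  rw [mem_signedBoxes (by omega), mem_signedBoxes (by omega)]
  refine and_congr_right fun hy => ?_
  by_cases hne : y = x
  · subst hne
    simp [h.isAddable, h.isRemovable]
  · obtain ⟨h1, h2⟩ := h.isAddable_isRemovable_iff hℓ hy hne
    rw [h1, h2]

/-- Adding a box turns its sign from `+` to `-` and keeps the other signs of its residue. -/
theorem signature_eq_append (h : IsExtension μ ν x) {ℓ : ℕ} (hℓ : 2 ≤ ℓ)
    {u v : List (Bool × (ℕ × ℕ))} {b : Bool}
    (hν : signature ℓ (residue ℓ x) ν = u ++ (b, x) :: v) :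
    signature ℓ (residue ℓ x) μ = u ++ (true, x) :: v := by
  classical
  obtain ⟨p, q, hL, rfl, rfl, -⟩ := exists_signedBoxes_eq_of_signature_eq hν
  have hpw := pairwise_signedBoxes hℓ (residue ℓ x) ν
  rw [hL, List.pairwise_append, List.pairwise_cons] at hpw
  have key (y) (hy : y ∈ p ∨ y ∈ q) : decide (IsAddable μ y) = decide (IsAddable ν y) := by
    have hyL : y ∈ signedBoxes ℓ (residue ℓ x) ν := by
      rw [hL]
      simp [or_left_comm, hy]
    have hne : y ≠ x := by
      rintro rfl
      rcases hy with hy | hy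
      · have := hpw.2.2 y hy y List.mem_cons_self
        exact this.asymm this
      · have := hpw.2.1.1 y hy
        exact this.asymm this
    rw [decide_eq_decide]
    exact (h.isAddable_isRemovable_iff hℓ ((mem_signedBoxes (by omega)).1 hyL).1 hne).1.symm
  rw [signature_eq, h.signedBoxes_eq hℓ, hL, List.map_append, List.map_cons,
    decide_eq_true h.isAddable,
    List.map_congr_left (f := fun y => (decide (IsAddable μ y), y)) (l := p)
      fun y hy => by rw [key y (Or.inl hy)],
    List.map_congr_left (f := fun y => (decide (IsAddable μ y), y)) (l := q)
      fun y hy => by rw [key y (Or.inr hy)]]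

end IsExtension

theorem exists_isExtension_of_isRemovable {ν : YoungDiagram} {x : ℕ × ℕ} (h : IsRemovable ν x) :
    ∃ μ, IsExtension μ ν x :=
  ⟨⟨ν.cells.erase x, h.2⟩, by simp, (Finset.insert_erase h.1).symm⟩

theorem IsExtension.addBox_eq {μ ν : YoungDiagram} {x : ℕ × ℕ} (h : IsExtension μ ν x) :
    addBox μ x = some ν := by
  unfold addBox
  rw [dif_pos h.isAddable.2, Option.some_inj]
  exact YoungDiagram.ext h.2.symm

theorem isExtension_of_addBox_eq {μ ν : YoungDiagram} {x : ℕ × ℕ} (hx : x ∉ μ.cells)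
    (h : addBox μ x = some ν) : IsExtension μ ν x := by
  unfold addBox at h
  split_ifs at h
  rw [Option.some_inj] at h
  exact ⟨hx, h ▸ rfl⟩

/-! ### Diagrams in which no row ends on the ladder below a column -/

/-- No row of `μ` ends on the same ladder as the position below a column that the row meets. -/
def IsLadderFree (ℓ : ℕ) (μ : YoungDiagram) : Prop :=
  ∀ r c, (r, c) ∈ μ → ladder ℓ (r, μ.rowLen r) ≠ ladder ℓ (μ.colLen c, c + 1)

theorem isLadderFree_iff {ℓ : ℕ} (hℓ : 1 ≤ ℓ) {μ : YoungDiagram} :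
    IsLadderFree ℓ μ ↔ ¬ ∃ x ∈ μ.cells, hook μ x = ℓ * arm μ x := by
  obtain ⟨m, rfl⟩ : ∃ m, ℓ = m + 1 := ⟨ℓ - 1, by omega⟩
  unfold IsLadderFree
  push Not
  rw [Prod.forall]
  refine forall₃_congr fun r c h => not_congr ?_
  have h1 := YoungDiagram.mem_iff_lt_rowLen.1 h
  have h2 := YoungDiagram.mem_iff_lt_colLen.1 h
  obtain ⟨a, ha⟩ := Nat.exists_eq_add_of_le h1
  obtain ⟨b, hb⟩ := Nat.exists_eq_add_of_le h2
  simp only [ladder, hook, arm, leg, ha, hb, Nat.add_sub_cancel]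
  have e1 : c + 1 + a - (c + 1) = a := by omega
  have e2 : r + 1 + b - (r + 1) = b := by omega
  simp only [Nat.succ_eq_add_one, e1, e2, mul_add, add_mul, mul_one, one_mul]
  omega

/-- The hypothesis `H` is what cancellation provides when `x` is the rightmost surviving `+`. A
coincidence in the new diagram must involve the row or the column of `x`, and each case is traced
back to one in `μ`. -/
theorem isLadderFree_of_isExtension {ℓ : ℕ} (hℓ : 2 ≤ ℓ) {μ ν : YoungDiagram} {x : ℕ × ℕ}
    (h : IsExtension μ ν x) (hμ : IsLadderFree ℓ μ)
    (H : ∀ y, IsAddable μ y → residue ℓ y = residue ℓ x → ReadsBefore ℓ x y →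
      ∃ z, IsRemovable μ z ∧ residue ℓ z = residue ℓ x ∧ ReadsBefore ℓ x z ∧
        ReadsBefore ℓ z y) :
    IsLadderFree ℓ ν := by
  obtain ⟨m, rfl⟩ : ∃ m, ℓ = m + 1 := ⟨ℓ - 1, by omega⟩
  obtain ⟨r, c⟩ := x
  obtain ⟨h1, h2⟩ := isAddable_iff.1 h.isAddable
  obtain ⟨h3, h4⟩ := isRemovable_iff.1 h.isRemovable
  intro r' j hmem heq
  have hμ' (a b) (ha : a < μ.colLen b) :
      a + m * μ.rowLen a ≠ μ.colLen b + m * b + m := by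
    have := hμ a b (YoungDiagram.mem_iff_lt_colLen.2 ha)
    simpa only [ladder, Nat.add_sub_cancel, mul_add, mul_one, add_assoc] using this
  simp only [residue_eq_iff (show 1 ≤ m + 1 by omega), ReadsBefore, ladder, Nat.add_sub_cancel,
    Prod.forall, Prod.exists, isAddable_iff, isRemovable_iff] at H heq
  have hm1 := YoungDiagram.mem_iff_lt_rowLen.1 hmem
  have hm2 := YoungDiagram.mem_iff_lt_colLen.1 hmem
  by_cases hr : r' = r
  · subst hr
    by_cases hj : j = c
    · subst hj
      rw [h3, h4] at heq
      omega
    · rw [h3] at heq hm1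
      rw [h.colLen_of_ne hj] at heq hm2
      have hjc : m * (j + 1) ≤ m * c := Nat.mul_le_mul_left m (by omega)
      simp only [mul_add, mul_one] at heq hjc
      -- The position below column `j` is on the ladder of `x`, lower down. If it is addable, `H`
      -- gives a removable box between, whose row coincides with column `j`. If not, column `j - 1`
      -- is equally long and coincides with the old row of `x`.
      by_cases hs : μ.rowLen (μ.colLen j) = j
      · obtain ⟨r₂, c₂, ⟨hz1, hz2⟩, -, hz3, hz4⟩ := H (μ.colLen j) j ⟨hs, rfl⟩
          (by rw [show μ.colLen j + m * j = r' + m * c by omega]) (by omega)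
        apply hμ' r₂ j (by omega)
        rw [hz1, mul_add]
        omega
      · have hlt : ¬ j < μ.rowLen (μ.colLen j) := by
          rw [← YoungDiagram.mem_iff_lt_rowLen, YoungDiagram.mem_iff_lt_colLen]
          omega
        obtain ⟨j, rfl⟩ : ∃ k, j = k + 1 := ⟨j - 1, by omega⟩
        have hle : ¬ μ.colLen j > μ.colLen (j + 1) := by
          rw [gt_iff_lt, ← YoungDiagram.mem_iff_lt_colLen, YoungDiagram.mem_iff_lt_rowLen]
          omega
        have := μ.colLen_anti j (j + 1) (by omega)
        apply hμ' r' j (by omega)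
        rw [h1]
        simp only [mul_add, mul_one] at heq
        omega
  · rw [h.rowLen_of_ne hr] at heq hm1
    by_cases hj : j = c
    · subst hj
      rw [h4] at heq hm2
      simp only [mul_add, mul_one] at heq
      -- The position after row `r'` is exactly `ℓ` ladders beyond `x`. If it is not addable, the
      -- row above is equally long and coincides with the old column of `x`.
      by_cases hs : μ.colLen (μ.rowLen r') = r'
      · obtain ⟨r₂, c₂, ⟨hz1, hz2⟩, hz3, hz4, hz5⟩ := H r' (μ.rowLen r') ⟨rfl, hs⟩
          (by
            rw [show r' + m * μ.rowLen r' = r + m * j + (m + 1) by omega]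
            exact Nat.add_modEq_right) (by omega)
        -- No ladder of this residue lies strictly between, so the removable box is on one of the
        -- two end ladders: its column meets row `r'` or its row meets column `μ.rowLen r'`.
        rcases (show r₂ + m * c₂ = r + m * j ∨ r₂ + m * c₂ = r + m * j + (m + 1) by
          by_contra! hcon
          have hd := (Nat.modEq_iff_dvd' (by omega)).1 hz3.symm
          have := Nat.le_of_dvd (by omega) hd
          omega) with he | he
        · apply hμ' r' c₂ (by omega)
          omega
        · apply hμ' r₂ (μ.rowLen r') (by omega)
          rw [hz1, hs, mul_add]
          omega
      · have hlt : ¬ r' < μ.colLen (μ.rowLen r') := by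
          rw [← YoungDiagram.mem_iff_lt_colLen, YoungDiagram.mem_iff_lt_rowLen]
          omega
        obtain ⟨t, rfl⟩ : ∃ k, r' = k + 1 := ⟨r' - 1, by omega⟩
        have hle : ¬ μ.rowLen t > μ.rowLen (t + 1) := by
          rw [gt_iff_lt, ← YoungDiagram.mem_iff_lt_rowLen, YoungDiagram.mem_iff_lt_colLen]
          omega
        have := μ.rowLen_anti t (t + 1) (by omega)
        apply hμ' t j (by omega)
        rw [show μ.rowLen t = μ.rowLen (t + 1) by omega]
        omega
    · rw [h.colLen_of_ne hj] at heq hm2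
      apply hμ' r' j hm2
      rw [heq]
      ring

/-- The mirror image of `isLadderFree_of_isExtension`: bottoms of columns and ends of rows replace
the positions just outside, and addable boxes before `x` replace removable boxes after it. -/
theorem isLadderFree_of_isExtension' {ℓ : ℕ} (hℓ : 2 ≤ ℓ) {μ ν : YoungDiagram} {x : ℕ × ℕ}
    (h : IsExtension μ ν x) (hν : IsLadderFree ℓ ν)
    (H : ∀ y, IsRemovable ν y → residue ℓ y = residue ℓ x → ReadsBefore ℓ y x →
      ∃ z, IsAddable ν z ∧ residue ℓ z = residue ℓ x ∧ ReadsBefore ℓ y z ∧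
        ReadsBefore ℓ z x) :
    IsLadderFree ℓ μ := by
  obtain ⟨m, rfl⟩ : ∃ m, ℓ = m + 1 := ⟨ℓ - 1, by omega⟩
  obtain ⟨r, c⟩ := x
  obtain ⟨h1, h2⟩ := isAddable_iff.1 h.isAddable
  obtain ⟨h3, h4⟩ := isRemovable_iff.1 h.isRemovable
  intro r' j hmem heq
  have hν' (a b) (ha : a < ν.colLen b) :
      a + m * ν.rowLen a ≠ ν.colLen b + m * b + m := by
    have := hν a b (YoungDiagram.mem_iff_lt_colLen.2 ha)
    simpa only [ladder, Nat.add_sub_cancel, mul_add, mul_one, add_assoc] using this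
  simp only [residue_eq_iff (show 1 ≤ m + 1 by omega), ReadsBefore, ladder, Nat.add_sub_cancel,
    Prod.forall, Prod.exists, isAddable_iff, isRemovable_iff] at H heq
  have hm1 := YoungDiagram.mem_iff_lt_rowLen.1 hmem
  have hm2 := YoungDiagram.mem_iff_lt_colLen.1 hmem
  by_cases hr : r' = r
  · subst hr
    have hj : j ≠ c := by omega
    rw [h1] at heq
    rw [← h.colLen_of_ne hj] at heq hm2
    simp only [mul_add, mul_one] at heq
    obtain ⟨s, hs⟩ : ∃ s, ν.colLen j = s + 1 := ⟨ν.colLen j - 1, by omega⟩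
    -- The bottom of column `j` is `ℓ` ladders before `x`. If it is not removable, column `j + 1` is
    -- equally long and coincides with the row of `x` in `ν`.
    by_cases hsr : ν.rowLen s = j + 1
    · obtain ⟨r₂, c₂, ⟨hz1, hz2⟩, hz3, hz4, hz5⟩ := H s j ⟨hsr, hs⟩
        (by
          rw [show r' + m * c = s + m * j + (m + 1) by omega]
          exact Nat.add_modEq_right.symm) (by omega)
      rcases (show r₂ + m * c₂ = r' + m * c ∨ r₂ + m * c₂ + (m + 1) = r' + m * c by
        by_contra! hcon
        have hd := (Nat.modEq_iff_dvd' (by omega)).1 hz3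
        have := Nat.le_of_dvd (by omega) hd
        omega) with he | he
      · apply hν' r₂ j (by omega)
        rw [hz1]
        omega
      · apply hν' s c₂ (by omega)
        rw [hsr, mul_add]
        omega
    · have hlt : j < ν.rowLen s := by
        rw [← YoungDiagram.mem_iff_lt_rowLen, YoungDiagram.mem_iff_lt_colLen]
        omega
      have hle : s < ν.colLen (j + 1) := by
        rw [← YoungDiagram.mem_iff_lt_colLen, YoungDiagram.mem_iff_lt_rowLen]
        omega
      have := ν.colLen_anti j (j + 1) (by omega)
      apply hν' r' (j + 1) (by omega)
      rw [h3]
      simp only [mul_add, mul_one]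
      omega
  · rw [← h.rowLen_of_ne hr] at heq hm1
    by_cases hj : j = c
    · subst hj
      rw [h2] at heq hm2
      simp only [mul_add, mul_one] at heq
      obtain ⟨t, ht⟩ : ∃ t, ν.rowLen r' = t + 1 := ⟨ν.rowLen r' - 1, by omega⟩
      rw [ht] at heq
      simp only [mul_add, mul_one] at heq
      -- The end of row `r'` is on the ladder of `x`, higher up. If it is not removable, row `r' +
      -- 1` is equally long and coincides with the column of `x` in `ν`.
      by_cases hs : ν.colLen t = r' + 1
      · obtain ⟨r₂, c₂, ⟨hz1, hz2⟩, -, hz3, hz4⟩ := H r' t ⟨ht, hs⟩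
          (by rw [show r' + m * t = r + m * j by omega]) (by omega)
        apply hν' r' c₂ (by omega)
        rw [ht, mul_add]
        omega
      · have hlt : r' < ν.colLen t := by
          rw [← YoungDiagram.mem_iff_lt_colLen, YoungDiagram.mem_iff_lt_rowLen]
          omega
        have hle : t < ν.rowLen (r' + 1) := by
          rw [← YoungDiagram.mem_iff_lt_rowLen, YoungDiagram.mem_iff_lt_colLen]
          omega
        have := ν.rowLen_anti r' (r' + 1) (by omega)
        apply hν' (r' + 1) j (by omega)
        rw [show ν.rowLen (r' + 1) = t + 1 by omega, mul_add]
        omega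
    · rw [← h.colLen_of_ne hj] at heq hm2
      apply hν' r' j hm2
      rw [heq]
      ring

/-- A box on the rightmost ladder is removable, and no addable box of its residue follows. -/
theorem IsLadderFree.exists_false_mem_reduceWord {ℓ : ℕ} (hℓ : 2 ≤ ℓ) {μ : YoungDiagram}
    (hμ : IsLadderFree ℓ μ) (hne : μ.cells.Nonempty) :
    ∃ i, ∃ s ∈ reduceWord (signature ℓ i μ), s.1 = false := by
  obtain ⟨m, rfl⟩ : ∃ m, ℓ = m + 1 := ⟨ℓ - 1, by omega⟩
  obtain ⟨⟨r, c⟩, hx, hmax⟩ := μ.cells.exists_max_image (ladder (m + 1)) hne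
  simp only [ladder, Nat.add_sub_cancel, Prod.forall, YoungDiagram.mem_cells] at hmax
  have hx1 := YoungDiagram.mem_iff_lt_rowLen.1 hx
  have hx2 := YoungDiagram.mem_iff_lt_colLen.1 hx
  have hrem1 : μ.rowLen r = c + 1 := by
    by_contra hcon
    have := hmax r (c + 1) (YoungDiagram.mem_iff_lt_rowLen.2 (by omega))
    rw [mul_add] at this
    omega
  have hrem2 : μ.colLen c = r + 1 := by
    by_contra hcon
    have := hmax (r + 1) c (YoungDiagram.mem_iff_lt_colLen.2 (by omega))
    omega
  refine ⟨_, exists_false_mem_reduceWord_signature hℓ (isRemovable_iff.2 ⟨hrem1, hrem2⟩) ?_⟩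
  rintro ⟨s, j⟩ hy hres hxy
  rw [isAddable_iff] at hy
  obtain ⟨hy1, hy2⟩ := hy
  rw [residue_eq_iff (by omega)] at hres
  simp only [ReadsBefore, ladder, Nat.add_sub_cancel] at hres hxy
  rcases hxy with hlt | ⟨heq, hlt⟩
  -- Such an addable box is at least `ℓ` ladders further right. A step left costs only `ℓ - 1`
  -- ladders (a step up only one), so its left or upper neighbour would lie beyond the maximal
  -- ladder.
  · have hle := Nat.le_of_dvd (by omega) ((Nat.modEq_iff_dvd' hlt.le).1 hres.symm)
    rcases Nat.eq_zero_or_pos j with rfl | hj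
    · rcases Nat.eq_zero_or_pos s with rfl | hs
      · omega
      · have := hmax (s - 1) 0 (YoungDiagram.mem_iff_lt_colLen.2 (by omega))
        omega
    · obtain ⟨j, rfl⟩ : ∃ k, j = k + 1 := ⟨j - 1, by omega⟩
      have := hmax s j (YoungDiagram.mem_iff_lt_rowLen.2 (by omega))
      rw [mul_add] at hle hlt
      omega
  -- Lower down on the same ladder, column `j` coincides with row `r`.
  · apply hμ r j (YoungDiagram.mem_iff_lt_colLen.2 (by omega))
    simp only [ladder, Nat.add_sub_cancel, hrem1, hy2, mul_add]
    omega

/-! ### The nodes of the ladder crystal -/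

theorem exists_of_fHat_eq {ℓ : ℕ} (hℓ : 2 ≤ ℓ) {i : ZMod ℓ} {μ ν : YoungDiagram}
    (h : fHat ℓ i μ = some ν) :
    ∃ x u v, residue ℓ x = i ∧ IsExtension μ ν x ∧ signature ℓ i μ = u ++ (true, x) :: v ∧
      ∀ t ∈ reduceWord v, t.1 = false := by
  obtain ⟨x, hx, hadd⟩ := Option.bind_eq_some_iff.1 h
  obtain ⟨⟨b, x⟩, hs, rfl⟩ := Option.map_eq_some_iff.1 hx
  obtain ⟨hb, u, v, hw, hv⟩ := exists_eq_append_of_getLast?_reduceWord hs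
  obtain rfl : b = true := hb
  obtain ⟨p, q, hL, -, -, hadd'⟩ := exists_signedBoxes_eq_of_signature_eq hw
  have hmem : x ∈ signedBoxes ℓ i μ := by simp [hL]
  exact ⟨x, u, v, ((mem_signedBoxes (by omega)).1 hmem).1,
    isExtension_of_addBox_eq (hadd'.1 rfl).1 hadd, hw, hv⟩

theorem IsNode.isLadderFree {ℓ : ℕ} (hℓ : 2 ≤ ℓ) {μ : YoungDiagram} (h : IsNode ℓ μ) :
    IsLadderFree ℓ μ := by
  induction h with
  | empty => exact fun r c h => absurd h (YoungDiagram.notMem_bot _)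
  | step i _ hf ih =>
    obtain ⟨x, u, v, rfl, hext, hw, hv⟩ := exists_of_fHat_eq hℓ hf
    exact isLadderFree_of_isExtension hℓ hext ih fun y hy hyi hxy =>
      exists_isRemovable_between hℓ hw hv hy hyi hxy

theorem IsLadderFree.exists_fHat_eq {ℓ : ℕ} (hℓ : 2 ≤ ℓ) {ν : YoungDiagram}
    (hν : IsLadderFree ℓ ν) (hne : ν.cells.Nonempty) :
    ∃ i μ, IsLadderFree ℓ μ ∧ μ.card < ν.card ∧ fHat ℓ i μ = some ν := by
  obtain ⟨i, hi⟩ := hν.exists_false_mem_reduceWord hℓ hne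
  obtain ⟨u, x, v, hw, hu, hv⟩ := exists_eq_append_of_false_mem_reduceWord hi
  obtain ⟨p, q, hL, -, -, hx⟩ := exists_signedBoxes_eq_of_signature_eq hw
  have hmem : x ∈ signedBoxes ℓ i ν := by simp [hL]
  obtain ⟨rfl, hx'⟩ := (mem_signedBoxes (by omega)).1 hmem
  have hrem : IsRemovable ν x := hx'.resolve_left fun h => by simpa using hx.2 h
  obtain ⟨μ, hext⟩ := exists_isExtension_of_isRemovable hrem
  refine ⟨residue ℓ x, μ, isLadderFree_of_isExtension' hℓ hext hν fun y hy hyi hyx =>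
    exists_isAddable_between hℓ hw hu hy hyi hyx, ?_, ?_⟩
  · rw [YoungDiagram.card, YoungDiagram.card, hext.2, Finset.card_insert_of_notMem hext.1]
    exact Nat.lt_succ_self _
  · rw [fHat, cogoodBox, hext.signature_eq_append hℓ hw, getLast?_filter_reduceWord hu hv]
    exact hext.addBox_eq

theorem IsLadderFree.isNode {ℓ : ℕ} (hℓ : 2 ≤ ℓ) {ν : YoungDiagram} (hν : IsLadderFree ℓ ν) :
    IsNode ℓ ν := by
  induction hn : ν.card using Nat.strong_induction_on generalizing ν with
  | _ n ih =>
    subst hn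
    rcases ν.cells.eq_empty_or_nonempty with h | h
    · obtain rfl : ν = ⊥ := YoungDiagram.ext h
      exact IsNode.empty
    · obtain ⟨i, μ, hμ, hlt, hf⟩ := hν.exists_fHat_eq hℓ h
      exact IsNode.step i (ih _ hlt hμ rfl) hf

theorem isNode_iff {ℓ : ℕ} (hℓ : 2 ≤ ℓ) {μ : YoungDiagram} :
    IsNode ℓ μ ↔ ¬ ∃ x ∈ μ.cells, hook μ x = ℓ * arm μ x := by
  rw [← isLadderFree_iff (by omega)]
  exact ⟨fun h => h.isLadderFree hℓ, fun h => h.isNode hℓ⟩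

theorem IsLPartition.isNode {ℓ : ℕ} (hℓ : 3 ≤ ℓ) {μ : YoungDiagram} (h : IsLPartition ℓ μ) :
    IsNode ℓ μ := by
  rw [isNode_iff (by omega)]
  rintro ⟨x, hx, he⟩
  refine h ⟨x, hx, he ▸ dvd_mul_right _ _, ?_⟩
  obtain ⟨m, rfl⟩ : ∃ m, ℓ = m + 1 := ⟨ℓ - 1, by omega⟩
  unfold hook at he
  rw [Nat.add_sub_cancel]
  generalize arm μ x = a at *
  generalize leg μ x = b at *
  rw [add_mul, one_mul] at he
  -- A forbidden box has `(ℓ - 1) * arm = leg + 1`, which gives the second inequality. The first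
  -- needs `ℓ ≥ 3`: it fails for `ℓ = 2`, where `arm = leg + 1`.
  have hb : m * a = b + 1 := by omega
  have ha : 0 < a := Nat.pos_of_ne_zero fun h0 => by simp [h0] at hb
  have h2a : 2 * a ≤ m * a := Nat.mul_le_mul_right a (by omega)
  have h2b : 2 * b ≤ m * b := Nat.mul_le_mul_right b (by omega)
  omega

end LadderCrystal

theorem mainTheorem11 (ℓ : ℕ) (hℓ : 3 ≤ ℓ) :
    (∀ μ : YoungDiagram, LadderCrystal.IsNode ℓ μ ↔
      ¬ ∃ x ∈ μ.cells, LadderCrystal.hook μ x = ℓ * LadderCrystal.arm μ x) ∧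
    (∀ μ : YoungDiagram, LadderCrystal.IsLPartition ℓ μ → LadderCrystal.IsNode ℓ μ) :=
  ⟨fun _ => LadderCrystal.isNode_iff (by omega), fun _ h => h.isNode hℓ⟩
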